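/- All graphs are finite and simple. An edge-coloring $c\colon E(G)\to\mathbb{Z}$ of a graph $G$ is an interval coloring if, at every vertex $x$, the edges incident to $x$ receive pairwise distinct colors and these colors form a (possibly empty) set of consecutive integers; $G$ is interval colorable if it has an interval coloring. The interval thickness $\theta(G)$ is the smallest integer $k\ge 0$ such that $E(G)$ can be partitioned into the edge sets of $k$ interval colorable graphs. Write $|G|$ and $\|G\|$ for the numbers of vertices and edges of $G$. Theorem. For every real $\gamma$ with $0<\gamma<1/2$ there exists $M\in\mathbb{N}$ such that every graph $G$ contains a subgraph $G'$ with $\theta(G')\le M$ and $\|G\|-\|G'\|\le\gamma|G|^2$. -/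

import Mathlib

namespace SimpleGraph

/-- The edge-coloring `c` (only its values on edges of `G` matter) is an interval coloring of `G`:
at every vertex `x` the colors of the edges incident to `x` are pairwise distinct and
form a (possibly empty) set of consecutive integers. -/
def IsIntervalColoring {V : Type*} (G : SimpleGraph V) (c : Sym2 V → ℤ) : Prop :=
  ∀ x : V, Set.InjOn (fun y => c s(x, y)) (G.neighborSet x) ∧
    Set.OrdConnected ((fun y => c s(x, y)) '' G.neighborSet x)

/-- `G` has an interval coloring. -/
def IntervalColorable {V : Type*} (G : SimpleGraph V) : Prop :=
  ∃ c : Sym2 V → ℤ, G.IsIntervalColoring c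

/-- The edge set of `G` is the disjoint union of the edge sets of `k` interval colorable graphs. -/
def HasIntervalDecomposition {V : Type*} (G : SimpleGraph V) (k : ℕ) : Prop :=
  ∃ H : Fin k → SimpleGraph V,
    (∀ i, (H i).IntervalColorable) ∧
    (∀ i j, i ≠ j → Disjoint (H i).edgeSet (H j).edgeSet) ∧
    (⋃ i, (H i).edgeSet) = G.edgeSet

/-- The interval thickness of `G`: the least `k` such that `G` can be edge-decomposed into `k`
interval colorable graphs (`⊤` if there is no such `k`). -/
noncomputable def intervalThickness {V : Type*} (G : SimpleGraph V) : ℕ∞ :=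
  ⨅ (k : ℕ) (_ : G.HasIntervalDecomposition k), (k : ℕ∞)

end SimpleGraph

/-! A graph with more than `γ n²` edges contains an interval colorable subgraph with at least `c n²`
edges, where `c > 0` depends only on `γ`. Removing such subgraphs one after the other, at most
`1 / c` of them are removed before no more than `γ n²` edges remain, and the union of the removed
subgraphs is `G'`.

The subgraph is found by Szemerédi's regularity lemma. It yields an `η`-uniform pair of parts of
density at least `8 η` whose sizes are linear in `n` (`exists_dense_uniform_pair`). Discarding the
few vertices of low degree leaves two sets `A` and `B` of equal size, such that all degrees between
them are large and any two large subsets span many edges. Both properties survive the removal of a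
few perfect matchings, and together with `#A = #B` they imply Hall's condition
(`exists_perfect_matching`). So one can extract a linear number `r` of disjoint perfect matchings
(`exists_isOneFactorization`). Coloring the `i`-th matching with color `i` is an interval coloring
of their union: every vertex of `A ∪ B` sees exactly the colors `0, …, r - 1`. -/

namespace SimpleGraph

open Finset

section

open scoped Classical

variable {V : Type*}

/-! ### One-factorizations -/

/-- `c` splits the edges of `H` into `r` perfect matchings of the vertex set `S`, the matching with
index `i` consisting of the edges of color `i`. In particular `H` is `r`-regular on `S` and has no
edges elsewhere. -/
def IsOneFactorization (H : SimpleGraph V) (S : Finset V) (r : ℕ) (c : Sym2 V → ℕ) : Prop :=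
  (∀ x y, H.Adj x y → x ∈ S ∧ c s(x, y) < r) ∧
    ∀ x ∈ S, ∀ i < r, ∃! y, H.Adj x y ∧ c s(x, y) = i

theorem IsOneFactorization.intervalColorable {H : SimpleGraph V} {S : Finset V} {r : ℕ}
    {c : Sym2 V → ℕ} (h : H.IsOneFactorization S r c) : H.IntervalColorable := by
  refine ⟨fun e => (c e : ℤ), fun x => ⟨?_, ?_⟩⟩
  · intro y hy z hz hyz
    have hy' : H.Adj x y := hy
    have hz' : H.Adj x z := hz
    obtain ⟨hx, hr⟩ := h.1 x y hy'
    have hyz' : c s(x, y) = c s(x, z) := by simpa using hyz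
    exact (h.2 x hx _ hr).unique ⟨hy', rfl⟩ ⟨hz', hyz'.symm⟩
  · refine ⟨?_⟩
    rintro _ ⟨y, hy, rfl⟩ _ ⟨z, hz, rfl⟩ k ⟨hk₁, hk₂⟩
    have hz' : H.Adj x z := hz
    obtain ⟨hx, hr⟩ := h.1 x z hz'
    dsimp only at hk₁ hk₂
    lift k to ℕ using by omega
    obtain ⟨w, ⟨hw, hc⟩, -⟩ := h.2 x hx k (by omega)
    exact ⟨w, hw, by simp [hc]⟩

theorem IsOneFactorization.mul_card_le [Fintype V] {H : SimpleGraph V} {S : Finset V} {r : ℕ}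
    {c : Sym2 V → ℕ} (h : H.IsOneFactorization S r c) : r * #S ≤ 2 * H.edgeSet.ncard := by
  have hdeg : ∀ x ∈ S, r ≤ H.degree x := by
    intro x hx
    have hsub : range r ⊆ (H.neighborFinset x).image fun y => c s(x, y) := by
      intro i hi
      obtain ⟨y, ⟨hy, hc⟩, -⟩ := h.2 x hx i (mem_range.1 hi)
      exact mem_image.2 ⟨y, by simpa using hy, hc⟩
    simpa using (card_le_card hsub).trans card_image_le
  calc r * #S = ∑ _x ∈ S, r := by simp [mul_comm]
    _ ≤ ∑ x ∈ S, H.degree x := sum_le_sum hdeg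
    _ ≤ ∑ x, H.degree x := sum_le_sum_of_subset (subset_univ _)
    _ = 2 * H.edgeSet.ncard := by
      rw [H.sum_degrees_eq_twice_card_edges, ← coe_edgeFinset, Set.ncard_coe_finset]

/-! ### Disjoint perfect matchings in bipartite graphs -/

/-- Hall's condition holds for small sets because of the minimum degree `s`. For a large set `X`
with `#N(X) < #X`, each vertex of `B \ N(X)` has its neighbors in `A \ X`, so that `B \ N(X)` has
more than `#(A \ X) ≥ s` elements, and `X` and `B \ N(X)` are large sets without an edge. -/
theorem exists_perfect_matching {G : SimpleGraph V} {A B : Finset V} {s : ℕ}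
    (hAB : Disjoint A B) (hcard : #A = #B)
    (hA : ∀ a ∈ A, s ≤ #{b ∈ B | G.Adj a b}) (hB : ∀ b ∈ B, s ≤ #{a ∈ A | G.Adj b a})
    (hXY : ∀ X ⊆ A, ∀ Y ⊆ B, s ≤ #X → s ≤ #Y → ∃ x ∈ X, ∃ y ∈ Y, G.Adj x y) :
    ∃ M ≤ G, (∀ x y, M.Adj x y → x ∈ A ∪ B) ∧ ∀ x ∈ A ∪ B, ∃! y, M.Adj x y := by
  obtain ⟨g, hg, hgt⟩ := (all_card_le_biUnion_card_iff_exists_injective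
    (fun a : A => ({b ∈ B | G.Adj a b} : Finset V))).1 (by
      intro X'
      set X : Finset V := X'.map (Function.Embedding.subtype _) with hX
      have hXA : X ⊆ A := by
        intro x hx
        obtain ⟨y, -, rfl⟩ := mem_map.1 hx
        exact y.2
      set N := X'.biUnion fun a : A => ({b ∈ B | G.Adj a b} : Finset V) with hN
      have hmemN : ∀ x ∈ X, ∀ b ∈ B, G.Adj x b → b ∈ N := by
        intro x hx b hb hxb
        obtain ⟨y, hy, rfl⟩ := mem_map.1 hx
        exact mem_biUnion.2 ⟨y, hy, mem_filter.2 ⟨hb, hxb⟩⟩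
      have hNB : N ⊆ B := biUnion_subset.2 fun _ _ => filter_subset _ _
      have hXc : #X' = #X := (card_map _).symm
      rw [hXc]
      by_contra! hlt
      have hne : X.Nonempty := card_pos.1 (by omega)
      obtain ⟨x, hx⟩ := hne
      have hsN : s ≤ #N := (hA x (hXA hx)).trans (card_le_card fun b hb =>
        hmemN x hx b (mem_filter.1 hb).1 (mem_filter.1 hb).2)
      have hXle := card_le_card hXA
      have hY : #(B \ N) = #B - #N := card_sdiff_of_subset hNB
      have hZ : #(A \ X) = #A - #X := card_sdiff_of_subset hXA
      obtain ⟨y, hy⟩ : (B \ N).Nonempty := card_pos.1 (by omega)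
      have hsZ : s ≤ #(A \ X) := (hB y (mem_sdiff.1 hy).1).trans (card_le_card fun a ha =>
        mem_sdiff.2 ⟨(mem_filter.1 ha).1, fun haX => (mem_sdiff.1 hy).2
          (hmemN a haX y (mem_sdiff.1 hy).1 (mem_filter.1 ha).2.symm)⟩)
      obtain ⟨a, ha, b, hb, hab⟩ := hXY X hXA (B \ N) sdiff_subset (by omega) (by omega)
      exact (mem_sdiff.1 hb).2 (hmemN a ha b (mem_sdiff.1 hb).1 hab))
  have hgB : ∀ a, g a ∈ B := fun a => (mem_filter.1 (hgt a)).1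
  have hgG : ∀ a : A, G.Adj a (g a) := fun a => (mem_filter.1 (hgt a)).2
  have hnot : ∀ x ∈ A, x ∉ B := fun x hx hx' => Finset.disjoint_left.1 hAB hx hx'
  have hsurj : ∀ b ∈ B, ∃ a, g a = b := by
    intro b hb
    have himg : (univ : Finset A).image g = B := by
      apply eq_of_subset_of_card_le
      · intro b hb
        obtain ⟨a, -, rfl⟩ := mem_image.1 hb
        exact hgB a
      · rw [card_image_of_injective _ hg, card_univ, Fintype.card_coe, hcard]
    obtain ⟨a, -, ha⟩ := mem_image.1 (himg ▸ hb)
    exact ⟨a, ha⟩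
  refine ⟨⟨fun x y => (∃ a : A, a = x ∧ g a = y) ∨ ∃ a : A, a = y ∧ g a = x, ?_, ?_⟩, ?_, ?_, ?_⟩
  · refine ⟨?_⟩
    rintro x y (h | h)
    · exact Or.inr h
    · exact Or.inl h
  · refine ⟨?_⟩
    rintro x (⟨a, ha, hx⟩ | ⟨a, ha, hx⟩)
    · exact (hgG a).ne (ha.trans hx.symm)
    · exact (hgG a).ne (ha.trans hx.symm)
  · rintro x y (⟨a, rfl, rfl⟩ | ⟨a, rfl, rfl⟩)
    · exact hgG a
    · exact (hgG a).symm
  · rintro x y (⟨a, rfl, rfl⟩ | ⟨a, rfl, rfl⟩)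
    · exact mem_union_left _ a.2
    · exact mem_union_right _ (hgB a)
  · intro x hx
    rcases mem_union.1 hx with hx | hx
    · refine ⟨g ⟨x, hx⟩, Or.inl ⟨⟨x, hx⟩, rfl, rfl⟩, ?_⟩
      rintro y (⟨a, rfl, rfl⟩ | ⟨a, rfl, rfl⟩)
      · rfl
      · exact absurd (hgB a) (hnot _ hx)
    · obtain ⟨a, rfl⟩ := hsurj x hx
      refine ⟨a, Or.inr ⟨a, rfl, rfl⟩, ?_⟩
      rintro y (⟨a', ha', rfl⟩ | ⟨a', rfl, ha'⟩)
      · exact absurd hx (ha' ▸ hnot _ a'.2)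
      · rw [hg ha']

/-- Removing a perfect matching lowers every degree by at most one and the number of edges between
subsets of `A` and `B` by at most `#A`, so `r` perfect matchings can be removed one by one. -/
theorem exists_isOneFactorization {A B : Finset V} {s : ℕ} (hAB : Disjoint A B)
    (hcard : #A = #B) (r : ℕ) (G : SimpleGraph V)
    (hA : ∀ a ∈ A, s + r ≤ #{b ∈ B | G.Adj a b}) (hB : ∀ b ∈ B, s + r ≤ #{a ∈ A | G.Adj b a})
    (hXY : ∀ X ⊆ A, ∀ Y ⊆ B, s ≤ #X → s ≤ #Y → r * #A < #(G.interedges X Y)) :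
    ∃ H ≤ G, ∃ c, H.IsOneFactorization (A ∪ B) r c := by
  induction r generalizing G with
  | zero => exact ⟨⊥, bot_le, fun _ => 0, by simp [IsOneFactorization]⟩
  | succ r ih =>
    obtain ⟨M, hMG, hMS, hM⟩ := exists_perfect_matching (G := G) (s := s) hAB hcard
      (fun a ha => by have := hA a ha; omega) (fun b hb => by have := hB b hb; omega) (by
        intro X hX Y hY hsX hsY
        obtain ⟨⟨x, y⟩, h⟩ := card_pos.1 ((Nat.zero_le _).trans_lt (hXY X hX Y hY hsX hsY))
        obtain ⟨hx, hy, hxy⟩ := (mk_mem_interedges_iff G).1 h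
        exact ⟨x, hx, y, hy, hxy⟩)
    -- `F` is opaque so that its adjacency is decided classically, as for `G` and `M`.
    obtain ⟨F, hF⟩ : ∃ F, F = G \ M := ⟨_, rfl⟩
    have hFadj : ∀ x y, F.Adj x y ↔ G.Adj x y ∧ ¬ M.Adj x y := by simp [hF]
    have hdeg : ∀ x ∈ A ∪ B, ∀ T : Finset V,
        #{y ∈ T | G.Adj x y} ≤ #{y ∈ T | F.Adj x y} + 1 := by
      intro x hx T
      obtain ⟨z, hz, hzu⟩ := hM x hx
      refine (card_le_card (t := insert z {y ∈ T | F.Adj x y}) ?_).trans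
        (card_insert_le _ _)
      intro y hy
      obtain ⟨hyT, hxy⟩ := mem_filter.1 hy
      by_cases h : M.Adj x y
      · exact mem_insert.2 (Or.inl (hzu y h))
      · exact mem_insert_of_mem (mem_filter.2 ⟨hyT, (hFadj _ _).2 ⟨hxy, h⟩⟩)
    obtain ⟨H, hHG, c, hc⟩ := ih F
      (fun a ha => by have := hA a ha; have := hdeg a (mem_union_left _ ha) B; omega)
      (fun b hb => by have := hB b hb; have := hdeg b (mem_union_right _ hb) A; omega) (by
        intro X hX Y hY hsX hsY
        have h₁ := hXY X hX Y hY hsX hsY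
        have h₂ : #(G.interedges X Y) ≤ #(F.interedges X Y) + #(M.interedges X Y) := by
          refine (card_le_card ?_).trans (card_union_le _ _)
          rintro ⟨x, y⟩ h
          obtain ⟨hx, hy, hxy⟩ := (mk_mem_interedges_iff G).1 h
          by_cases hm : M.Adj x y
          · exact mem_union_right _ ((mk_mem_interedges_iff M).2 ⟨hx, hy, hm⟩)
          · exact mem_union_left _ ((mk_mem_interedges_iff _).2
              ⟨hx, hy, (hFadj _ _).2 ⟨hxy, hm⟩⟩)
        have h₃ : #(M.interedges X Y) ≤ #A := by
          apply card_le_card_of_injOn Prod.fst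
          · rintro ⟨x, y⟩ h
            exact hX ((mk_mem_interedges_iff M).1 h).1
          · rintro ⟨x, y⟩ h ⟨x', y'⟩ h' rfl
            obtain ⟨hx, -, hxy⟩ := (mk_mem_interedges_iff M).1 h
            obtain ⟨-, -, hxy'⟩ := (mk_mem_interedges_iff M).1 h'
            rw [(hM x (mem_union_left _ (hX hx))).unique hxy hxy']
        rw [add_mul, one_mul] at h₁
        omega)
    have hdisj : ∀ x y, H.Adj x y → ¬ M.Adj x y := fun x y h =>
      ((hFadj _ _).1 (hHG h)).2
    refine ⟨H ⊔ M, sup_le (hHG.trans (hF ▸ sdiff_le)) hMG,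
      fun e => if e ∈ M.edgeSet then r else c e, ?_, ?_⟩
    · rintro x y (h | h)
      · have := hc.1 x y h
        simp only [mem_edgeSet, hdisj x y h, if_false]
        exact ⟨this.1, this.2.trans (Nat.lt_succ_self r)⟩
      · exact ⟨hMS x y h, by simp [h]⟩
    · intro x hx i hi
      rcases Nat.lt_succ_iff_lt_or_eq.1 hi with hi | rfl
      · obtain ⟨y, ⟨hy, hyc⟩, hyu⟩ := hc.2 x hx i hi
        refine ⟨y, ⟨Or.inl hy, by simp [hdisj x y hy, hyc]⟩, ?_⟩
        rintro z ⟨hz, hzc⟩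
        by_cases hm : M.Adj x z
        · simp [hm] at hzc
          omega
        · simp only [mem_edgeSet, hm, if_false] at hzc
          exact hyu z ⟨hz.resolve_right hm, hzc⟩
      · obtain ⟨y, hy, hyu⟩ := hM x hx
        refine ⟨y, ⟨Or.inr hy, by simp [hy]⟩, ?_⟩
        rintro z ⟨hz, hzc⟩
        by_cases hm : M.Adj x z
        · exact hyu z hm
        · simp only [mem_edgeSet, hm, if_false] at hzc
          have := (hc.1 x z (hz.resolve_right hm)).2
          omega

/-! ### Dense uniform pairs -/

theorem IsUniform.lt_card_interedges {G : SimpleGraph V} {A B X Y : Finset V} {η : ℝ}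
    (hG : G.IsUniform η A B) (hd : 8 * η ≤ G.edgeDensity A B) (hX : X ⊆ A) (hY : Y ⊆ B)
    (hXA : #A * η ≤ #X) (hYB : #B * η ≤ #Y) :
    7 * η * (#X * #Y) < #(G.interedges X Y) := by
  have hη := hG.pos
  have h₁ := (abs_lt.1 (hG hX hY hXA hYB)).1
  have h₂ : 7 * η < G.edgeDensity X Y := by linarith
  rw [edgeDensity_def] at h₂
  push_cast at h₂
  have hpos : (0 : ℝ) < #X * #Y := by
    by_contra! hle
    have : (#X * #Y : ℝ) = 0 := le_antisymm hle (by positivity)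
    rw [this, div_zero] at h₂
    linarith
  exact (lt_div_iff₀ hpos).1 h₂

/-- In a dense uniform pair few vertices of `A` have a small degree into `B`. -/
theorem IsUniform.card_low_degree_lt {G : SimpleGraph V} {A B : Finset V} {η : ℝ}
    (hG : G.IsUniform η A B) (hη₁ : η ≤ 1) (hd : 8 * η ≤ G.edgeDensity A B) :
    (#{a ∈ A | (#{b ∈ B | G.Adj a b} : ℝ) < 7 * η * #B} : ℝ) < #A * η := by
  by_contra! hle
  set X : Finset V := {a ∈ A | (#{b ∈ B | G.Adj a b} : ℝ) < 7 * η * #B} with hX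
  have h := hG.lt_card_interedges hd (filter_subset _ _) (Subset.refl B) hle
    (mul_le_of_le_one_right (by positivity) hη₁)
  have h₂ : #(G.interedges X B) ≤ ∑ x ∈ X, #{b ∈ B | G.Adj x b} := by
    unfold interedges
    rw [Rel.interedges_eq_biUnion]
    refine card_biUnion_le.trans (le_of_eq ?_)
    simp only [card_map]
  have h₃ : (∑ x ∈ X, (#{b ∈ B | G.Adj x b} : ℝ)) ≤ ∑ _x ∈ X, 7 * η * #B :=
    sum_le_sum fun x hx => (mem_filter.1 hx).2.le
  have h₂' : (#(G.interedges X B) : ℝ) ≤ ∑ x ∈ X, (#{b ∈ B | G.Adj x b} : ℝ) := by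
    exact_mod_cast h₂
  rw [sum_const, nsmul_eq_mul] at h₃
  linarith

/-- Discarding the vertices of low degree, and then further vertices of the larger side, turns a
dense uniform pair into a balanced pair of large minimum degree. -/
theorem IsUniform.exists_balanced_subpair {G : SimpleGraph V} {A B : Finset V} {η : ℝ} {m : ℕ}
    (hG : G.IsUniform η A B) (hη₁ : η ≤ 1) (hd : 8 * η ≤ G.edgeDensity A B)
    (hAm : m ≤ #A) (hAm' : #A ≤ m + 1) (hBm : m ≤ #B) (hBm' : #B ≤ m + 1) (hm : 1 ≤ η * m) :
    ∃ A₁ ⊆ A, ∃ B₁ ⊆ B, #A₁ = #B₁ ∧ (1 - η) * m ≤ #A₁ ∧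
      (∀ a ∈ A₁, 5 * η * m ≤ #{b ∈ B₁ | G.Adj a b}) ∧
      ∀ b ∈ B₁, 5 * η * m ≤ #{a ∈ A₁ | G.Adj b a} := by
  have hη := hG.pos
  have hd' : 8 * η ≤ G.edgeDensity B A := by rwa [edgeDensity_comm]
  set A₀ : Finset V := {a ∈ A | ¬ (#{b ∈ B | G.Adj a b} : ℝ) < 7 * η * #B} with hA₀
  set B₀ : Finset V := {b ∈ B | ¬ (#{a ∈ A | G.Adj b a} : ℝ) < 7 * η * #A} with hB₀
  have cA := hG.card_low_degree_lt hη₁ hd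
  have cB := hG.symm.card_low_degree_lt hη₁ hd'
  have sA := card_filter_add_card_filter_not (s := A)
    (fun a => (#{b ∈ B | G.Adj a b} : ℝ) < 7 * η * #B)
  have sB := card_filter_add_card_filter_not (s := B)
    (fun b => (#{a ∈ A | G.Adj b a} : ℝ) < 7 * η * #A)
  rw [← @Nat.cast_inj ℝ] at sA sB
  push_cast at sA sB
  have rA : (m : ℝ) ≤ #A := by exact_mod_cast hAm
  have rA' : (#A : ℝ) ≤ m + 1 := by exact_mod_cast hAm'
  have rB : (m : ℝ) ≤ #B := by exact_mod_cast hBm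
  have rB' : (#B : ℝ) ≤ m + 1 := by exact_mod_cast hBm'
  obtain ⟨A₁, hA₁, kA⟩ := exists_subset_card_eq (min_le_left #A₀ #B₀)
  obtain ⟨B₁, hB₁, kB⟩ := exists_subset_card_eq (min_le_right #A₀ #B₀)
  have hmul : ∀ x : ℝ, m ≤ x → (1 - η) * m ≤ (1 - η) * x := fun x hx =>
    mul_le_mul_of_nonneg_left hx (by linarith)
  have hkm : (1 - η) * m ≤ (min #A₀ #B₀ : ℕ) := by
    rw [Nat.cast_min]
    apply le_min
    · have := hmul _ rA
      linarith
    · have := hmul _ rB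
      linarith
  -- Passing from `S` to `T` costs at most `#S - #T` neighbors.
  have hdeg : ∀ x : V, ∀ S T : Finset V, T ⊆ S → #T = min #A₀ #B₀ → (m : ℝ) ≤ #S →
      (#S : ℝ) ≤ m + 1 → ¬ (#{y ∈ S | G.Adj x y} : ℝ) < 7 * η * #S →
      5 * η * m ≤ #{y ∈ T | G.Adj x y} := by
    intro x S T hTS hT hS hS' hx
    have h₁ : #{y ∈ S | G.Adj x y} ≤ #{y ∈ T | G.Adj x y} + #(S \ T) := by
      refine (card_le_card ?_).trans (card_union_le _ _)
      intro y hy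
      obtain ⟨hyS, hxy⟩ := mem_filter.1 hy
      by_cases hyT : y ∈ T
      · exact mem_union_left _ (mem_filter.2 ⟨hyT, hxy⟩)
      · exact mem_union_right _ (mem_sdiff.2 ⟨hyS, hyT⟩)
    have h₂ : (#(S \ T) : ℝ) = #S - (min #A₀ #B₀ : ℕ) := by rw [cast_card_sdiff hTS, hT]
    have h₃ : (#{y ∈ S | G.Adj x y} : ℝ) ≤ #{y ∈ T | G.Adj x y} + #(S \ T) := by
      exact_mod_cast h₁
    have h₄ : 7 * η * m ≤ 7 * η * #S := by gcongr
    linarith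
  have hA₁A : A₁ ⊆ A := hA₁.trans (filter_subset _ _)
  have hB₁B : B₁ ⊆ B := hB₁.trans (filter_subset _ _)
  exact ⟨A₁, hA₁A, B₁, hB₁B, kA.trans kB.symm, kA ▸ hkm,
    fun a ha => hdeg a B B₁ hB₁B kB rB rB' (mem_filter.1 (hA₁ ha)).2,
    fun b hb => hdeg b A A₁ hA₁A kA rA rA' (mem_filter.1 (hB₁ hb)).2⟩

/-- In a balanced subpair degrees are at least `5 η m`, and sets of size at least `2 η m` span at
least `28 η³ m²` edges; this leaves room for `η³ m` disjoint perfect matchings. -/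
theorem IsUniform.exists_intervalColorable [Fintype V] {G : SimpleGraph V} {A B : Finset V}
    {η : ℝ} {m : ℕ} (hG : G.IsUniform η A B) (hd : 8 * η ≤ G.edgeDensity A B) (hAB : Disjoint A B)
    (hAm : m ≤ #A) (hAm' : #A ≤ m + 1) (hBm : m ≤ #B) (hBm' : #B ≤ m + 1)
    (hm : 2 ≤ η ^ 3 * m) :
    ∃ H ≤ G, H.IntervalColorable ∧ η ^ 3 * m ^ 2 / 4 ≤ H.edgeSet.ncard := by
  have hη := hG.pos
  have hη₁ : 8 * η ≤ 1 := hd.trans (by exact_mod_cast G.edgeDensity_le_one A B)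
  have hη₂ : η ^ 3 * m ≤ η * m := by
    gcongr
    exact pow_le_of_le_one hη.le (by linarith) (by norm_num)
  have hηm : η * m ≤ 1 / 8 * m := by gcongr; linarith
  obtain ⟨A₁, hA₁A, B₁, hB₁B, hcard, hkm, degA, degB⟩ := hG.exists_balanced_subpair
    (by linarith) hd hAm hAm' hBm hBm' (by linarith)
  have hAB₁ : Disjoint A₁ B₁ :=
    disjoint_of_subset_left hA₁A (disjoint_of_subset_right hB₁B hAB)
  have rA : (#A : ℝ) ≤ m + 1 := by exact_mod_cast hAm'
  have rB : (#B : ℝ) ≤ m + 1 := by exact_mod_cast hBm'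
  have rA₁ : (#A₁ : ℝ) ≤ #A := by exact_mod_cast card_le_card hA₁A
  obtain ⟨s, hs₁, hs₂⟩ : ∃ s : ℕ, 2 * η * m ≤ s ∧ (s : ℝ) < 2 * η * m + 1 :=
    ⟨⌈2 * η * m⌉₊, Nat.le_ceil _, Nat.ceil_lt_add_one (by positivity)⟩
  obtain ⟨r, hr₁, hr₂⟩ : ∃ r : ℕ, (r : ℝ) ≤ η ^ 3 * m ∧ η ^ 3 * m < r + 1 :=
    ⟨⌊η ^ 3 * m⌋₊, Nat.floor_le (by positivity), Nat.lt_floor_add_one _⟩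
  have hsr : ((s + r : ℕ) : ℝ) ≤ 5 * η * m := by push_cast; linarith
  have hsize : ∀ x : ℝ, x ≤ m + 1 → x * η ≤ s := by
    intro x hx
    have : x * η ≤ 2 * m * η := by gcongr; linarith
    linarith
  obtain ⟨H, hHG, c, hc⟩ := exists_isOneFactorization (s := s) hAB₁ hcard r G
    (fun a ha => by exact_mod_cast hsr.trans (degA a ha))
    (fun b hb => by exact_mod_cast hsr.trans (degB b hb)) (by
      intro X hX Y hY hsX hsY
      have hsX' : (s : ℝ) ≤ #X := by exact_mod_cast hsX
      have hsY' : (s : ℝ) ≤ #Y := by exact_mod_cast hsY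
      have h := hG.lt_card_interedges hd (hX.trans hA₁A) (hY.trans hB₁B)
        ((hsize _ rA).trans hsX') ((hsize _ rB).trans hsY')
      rw [← @Nat.cast_lt ℝ, Nat.cast_mul]
      refine lt_of_le_of_lt ?_ h
      calc (r : ℝ) * #A₁ ≤ (η ^ 3 * m) * (2 * m) := by gcongr; linarith
        _ ≤ 14 * ((η ^ 3 * m) * (2 * m)) := le_mul_of_one_le_left (by positivity) (by norm_num)
        _ = 7 * η * ((2 * η * m) * (2 * η * m)) := by ring
        _ ≤ 7 * η * (#X * #Y) := by gcongr <;> linarith)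
  refine ⟨H, hHG, hc.intervalColorable, ?_⟩
  have hcount := hc.mul_card_le
  rw [card_union_of_disjoint hAB₁, ← hcard] at hcount
  have hcount' : (r : ℝ) * #A₁ ≤ H.edgeSet.ncard := by
    have : r * #A₁ ≤ H.edgeSet.ncard := by linarith
    exact_mod_cast this
  calc η ^ 3 * m ^ 2 / 4 = (η ^ 3 * m / 2) * (m / 2) := by ring
    _ ≤ (r : ℝ) * #A₁ := by gcongr <;> linarith
    _ ≤ _ := hcount'

/-- If every pair of parts of the regularity partition were sparse or not uniform, then all edges
would lie inside parts, in non-uniform pairs or in sparse pairs, and there are fewer than `γ n²` such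
edges. -/
theorem exists_dense_uniform_pair [Fintype V] [Nonempty V] {G : SimpleGraph V}
    {P : Finpartition (univ : Finset V)} {γ : ℝ} (hγ : 0 < γ) (hP : P.IsEquipartition)
    (hPu : P.IsUniform G (γ / 36)) (hP' : 4 / γ ≤ #P.parts)
    (hG : γ * (Fintype.card V : ℝ) ^ 2 ≤ G.edgeSet.ncard) :
    ∃ A ∈ P.parts, ∃ B ∈ P.parts, A ≠ B ∧ G.IsUniform (γ / 36) A B ∧
      8 * (γ / 36) ≤ G.edgeDensity A B := by
  by_contra! hno
  set n : ℝ := (Fintype.card V : ℝ) with hn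
  have hn0 : 0 < n := by rw [hn]; exact_mod_cast Fintype.card_pos
  have hcover : ({e : V × V | G.Adj e.1 e.2} : Finset (V × V)) ⊆
      ((P.nonUniforms G (γ / 36)).biUnion (fun (U, V) ↦ U ×ˢ V) ∪ P.parts.biUnion offDiag) ∪
        (P.sparsePairs G (8 * (γ / 36))).biUnion fun (U, V) ↦ G.interedges U V := by
    rintro ⟨x, y⟩ hxy
    have hxy : G.Adj x y := by simpa using hxy
    obtain ⟨U, hU, hx⟩ := P.exists_mem (mem_univ x)
    obtain ⟨W, hW, hy⟩ := P.exists_mem (mem_univ y)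
    by_cases hUW : U = W
    · subst hUW
      exact mem_union_left _ (mem_union_right _ (mem_biUnion.2
        ⟨U, hU, mem_offDiag.2 ⟨hx, hy, hxy.ne⟩⟩))
    by_cases hu : G.IsUniform (γ / 36) U W
    · exact mem_union_right _ (mem_biUnion.2 ⟨(U, W), (P.mk_mem_sparsePairs G _ _ _).2
        ⟨hU, hW, hUW, hno U hU W hW hUW hu⟩, (mk_mem_interedges_iff G).2 ⟨hx, hy, hxy⟩⟩)
    · exact mem_union_left _ (mem_union_left _ (mem_biUnion.2 ⟨(U, W),
        (P.mk_mem_nonUniforms G).2 ⟨hU, hW, hUW, hu⟩, mem_product.2 ⟨hx, hy⟩⟩))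
  have hedges : 2 * G.edgeSet.ncard = #({e : V × V | G.Adj e.1 e.2} : Finset (V × V)) := by
    rw [← coe_edgeFinset, Set.ncard_coe_finset, two_mul_card_edgeFinset]
  have h₁ := hP.sum_nonUniforms_lt univ_nonempty (by positivity) hPu
  have h₂ := hP.card_biUnion_offDiag_le hγ hP'
  have h₃ := hP.card_interedges_sparsePairs_le (G := G) (ε := 8 * (γ / 36)) (by positivity)
  have h₄ := (card_le_card hcover).trans ((card_union_le _ _).trans
    (Nat.add_le_add_right (card_union_le _ _) _))
  rw [← hedges, ← @Nat.cast_le ℝ] at h₄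
  push_cast at h₄
  rw [card_univ, ← hn] at h₁ h₂ h₃
  have : 0 < γ * n ^ 2 := by positivity
  linarith

/-! ### Extracting interval colorable subgraphs -/

theorem intervalColorable_edge (x y : V) : (edge x y).IntervalColorable := by
  refine ⟨fun _ => 0, fun z => ⟨?_, ?_⟩⟩
  · intro a ha b hb _
    rw [mem_neighborSet, edge_adj] at ha hb
    grind
  · refine ⟨?_⟩
    rintro _ ⟨a, -, rfl⟩ _ ⟨b, hb, rfl⟩ k ⟨hk₁, hk₂⟩
    exact ⟨b, hb, le_antisymm hk₁ hk₂⟩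

end

/-- A dense graph has an interval colorable subgraph with a positive proportion of all pairs of
vertices as edges. -/
theorem exists_intervalColorable_le (γ : ℝ) (hγ : 0 < γ) :
    ∃ c : ℝ, 0 < c ∧ ∀ (V : Type*) [Fintype V] (G : SimpleGraph V),
      γ * (Fintype.card V : ℝ) ^ 2 < G.edgeSet.ncard →
        ∃ H ≤ G, H.IntervalColorable ∧ c * (Fintype.card V : ℝ) ^ 2 ≤ H.edgeSet.ncard := by
  classical
  set η : ℝ := γ / 36 with hη
  have hη0 : 0 < η := by positivity
  set l : ℕ := ⌈4 / γ⌉₊ with hl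
  set K : ℕ := SzemerediRegularity.bound η l with hK
  have hK0 : 0 < K := SzemerediRegularity.bound_pos _ _
  -- For more than `N` vertices the parts have at least `n / (2 K) ≥ 2 / η ^ 3` elements.
  set N : ℝ := l + 2 * K * (1 + 2 / η ^ 3) with hN
  have hN0 : 0 < N := by positivity
  refine ⟨min (1 / N ^ 2) (η ^ 3 / (16 * K ^ 2)), by positivity, ?_⟩
  intro V _ G hG
  set n : ℕ := Fintype.card V with hn
  obtain hle | hlt := le_or_gt (n : ℝ) N
  · -- For few vertices a single edge is enough.
    have hpos : (0 : ℝ) < G.edgeSet.ncard := lt_of_le_of_lt (by positivity) hG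
    have hne : G.edgeSet.Nonempty := (Set.ncard_pos (Set.toFinite _)).1 (by exact_mod_cast hpos)
    obtain ⟨e, he⟩ := hne
    induction e with | _ x y
    rw [mem_edgeSet] at he
    refine ⟨edge x y, (edge_le_iff (G := G)).2 (Or.inr he), intervalColorable_edge x y, ?_⟩
    rw [edgeSet_edge_of_ne he.ne, Set.ncard_singleton]
    calc _ ≤ 1 / N ^ 2 * (n : ℝ) ^ 2 := by gcongr; exact min_le_left _ _
      _ ≤ 1 / N ^ 2 * N ^ 2 := by gcongr
      _ = ((1 : ℕ) : ℝ) := by rw [Nat.cast_one]; field_simp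
  · have hln : l ≤ n := by
      have : (l : ℝ) ≤ n := le_trans (le_add_of_nonneg_right (by positivity)) hlt.le
      exact_mod_cast this
    have hn0 : 0 < n := by exact_mod_cast hN0.trans hlt
    have : Nonempty V := Fintype.card_pos_iff.1 hn0
    obtain ⟨P, hPe, hPl, hPK, hPu⟩ := szemeredi_regularity G hη0 hln
    have hP' : 4 / γ ≤ #P.parts := (Nat.le_ceil _).trans (by exact_mod_cast hPl)
    obtain ⟨A, hA, B, hB, hAB, hu, hd⟩ := exists_dense_uniform_pair hγ hPe hPu hP' hG.le
    set m : ℕ := n / #P.parts with hm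
    have hp0 : 0 < #P.parts := card_pos.2 ⟨A, hA⟩
    have hnm : n < K * (m + 1) := by
      calc n < #P.parts * (m + 1) := Nat.lt_mul_div_succ n hp0
        _ ≤ K * (m + 1) := Nat.mul_le_mul_right _ hPK
    have hnm' : (n : ℝ) < K * (m + 1) := by exact_mod_cast hnm
    have hKr : (0 : ℝ) < K := by exact_mod_cast hK0
    have hm₁ : 1 + 2 * (2 / η ^ 3) ≤ m := by
      have h1 : 2 * K * (1 + 2 / η ^ 3) < K * (m + 1) :=
        lt_of_le_of_lt (le_add_of_nonneg_left (by positivity)) (hlt.trans hnm')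
      have h2 : (K : ℝ) * (2 * (1 + 2 / η ^ 3)) < K * (m + 1) := by linarith
      have := lt_of_mul_lt_mul_left h2 hKr.le
      linarith
    have hm₂ : 2 ≤ η ^ 3 * m := by
      have h1 : 2 / η ^ 3 ≤ m := by
        have : 0 < 2 / η ^ 3 := by positivity
        linarith
      rw [div_le_iff₀ (by positivity)] at h1
      linarith
    have hm₃ : (1 : ℝ) ≤ m := by
      have : 0 < 2 / η ^ 3 := by positivity
      linarith
    have hcu : #(univ : Finset V) = n := card_univ
    have a1 := hPe.average_le_card_part hA
    have a2 := hPe.card_part_le_average_add_one hA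
    have b1 := hPe.average_le_card_part hB
    have b2 := hPe.card_part_le_average_add_one hB
    rw [hcu] at a1 a2 b1 b2
    obtain ⟨H, hHG, hH, hHe⟩ := hu.exists_intervalColorable hd (P.disjoint hA hB hAB)
      a1 a2 b1 b2 hm₂
    refine ⟨H, hHG, hH, le_trans ?_ hHe⟩
    have hnK : (n : ℝ) ≤ K * (2 * m) := hnm'.le.trans (by gcongr; linarith)
    calc _ ≤ η ^ 3 / (16 * K ^ 2) * (n : ℝ) ^ 2 := by gcongr; exact min_le_right _ _
      _ ≤ η ^ 3 / (16 * K ^ 2) * (K * (2 * m)) ^ 2 := by gcongr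
      _ = η ^ 3 * m ^ 2 / 4 := by field_simp; ring

theorem HasIntervalDecomposition.sup {V : Type*} {G H : SimpleGraph V} {k : ℕ}
    (hG : G.HasIntervalDecomposition k) (hH : H.IntervalColorable)
    (hGH : Disjoint G.edgeSet H.edgeSet) : (G ⊔ H).HasIntervalDecomposition (k + 1) := by
  obtain ⟨F, hF, hFd, hFu⟩ := hG
  have hsub : ∀ i, (F i).edgeSet ⊆ G.edgeSet := fun i =>
    hFu ▸ Set.subset_iUnion (fun i => (F i).edgeSet) i
  refine ⟨Fin.snoc F H, ?_, ?_, ?_⟩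
  · intro i
    induction i using Fin.lastCases with
    | last => simpa using hH
    | cast i => simpa using hF i
  · intro i j
    induction i using Fin.lastCases with
    | last =>
      induction j using Fin.lastCases with
      | last => intro h; exact absurd rfl h
      | cast j => intro _; simpa using (hGH.mono_left (hsub j)).symm
    | cast i =>
      induction j using Fin.lastCases with
      | last => intro _; simpa using hGH.mono_left (hsub i)
      | cast j => intro h; simpa using hFd i j (fun hij => h (by rw [hij]))
  · rw [edgeSet_sup, ← hFu]
    ext e
    simp only [Set.mem_iUnion, Set.mem_union]
    constructor
    · rintro ⟨i, hi⟩
      induction i using Fin.lastCases with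
      | last => right; simpa using hi
      | cast i => left; exact ⟨i, by simpa using hi⟩
    · rintro (⟨i, hi⟩ | h)
      · exact ⟨i.castSucc, by simpa using hi⟩
      · exact ⟨Fin.last k, by simpa using h⟩

/-- Greedy extraction: if every dense subgraph of `G` has a large interval colorable subgraph, then
at most `k` removals leave a sparse graph or cover `k * δ` edges. -/
theorem exists_hasIntervalDecomposition {V : Type*} [Fintype V] {G : SimpleGraph V} {t δ : ℝ}
    (h : ∀ F ≤ G, t < F.edgeSet.ncard → ∃ H ≤ F, H.IntervalColorable ∧ δ ≤ H.edgeSet.ncard)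
    (k : ℕ) : ∃ G' ≤ G, ∃ j ≤ k, G'.HasIntervalDecomposition j ∧
      ((G.edgeSet.ncard : ℝ) - G'.edgeSet.ncard ≤ t ∨ k * δ ≤ G'.edgeSet.ncard) := by
  induction k with
  | zero =>
    refine ⟨⊥, bot_le, 0, le_rfl, ⟨fun _ => ⊥, fun i => i.elim0, fun i => i.elim0, by simp⟩, ?_⟩
    right
    simp
  | succ k ih =>
    obtain ⟨G', hG', j, hj, hdec, hcase⟩ := ih
    by_cases hs : (G.edgeSet.ncard : ℝ) - G'.edgeSet.ncard ≤ t
    · exact ⟨G', hG', j, by omega, hdec, Or.inl hs⟩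
    have hcase := hcase.resolve_left hs
    have hcard : ((G \ G').edgeSet.ncard : ℝ) = G.edgeSet.ncard - G'.edgeSet.ncard := by
      rw [edgeSet_sdiff, eq_sub_iff_add_eq]
      exact_mod_cast Set.ncard_sdiff_add_ncard_of_subset (edgeSet_mono hG') (Set.toFinite _)
    obtain ⟨H, hH, hHc, hHe⟩ := h (G \ G') sdiff_le (by rw [hcard]; exact not_le.1 hs)
    have hd : Disjoint G'.edgeSet H.edgeSet := by
      refine Set.disjoint_left.2 fun e he he' => ?_
      have := edgeSet_mono hH he'
      rw [edgeSet_sdiff] at this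
      exact this.2 he
    refine ⟨G' ⊔ H, sup_le hG' (hH.trans sdiff_le), j + 1, by omega, hdec.sup hHc hd, Or.inr ?_⟩
    rw [edgeSet_sup, Set.ncard_union_eq hd (Set.toFinite _) (Set.toFinite _)]
    push_cast
    linarith

theorem HasIntervalDecomposition.intervalThickness_le {V : Type*} {G : SimpleGraph V} {k : ℕ}
    (h : G.HasIntervalDecomposition k) : G.intervalThickness ≤ (k : ℕ∞) :=
  iInf₂_le k h

theorem ncard_edgeSet_le_sq {V : Type*} [Fintype V] (G : SimpleGraph V) :
    (G.edgeSet.ncard : ℝ) ≤ (Fintype.card V : ℝ) ^ 2 := by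
  classical
  have h := G.card_edgeFinset_le_card_choose_two
  rw [← Set.ncard_coe_finset, coe_edgeFinset] at h
  exact_mod_cast h.trans (Nat.choose_le_pow _ 2)

end SimpleGraph

open SimpleGraph in
theorem mainTheorem2 (γ : ℝ) (hγ_pos : 0 < γ) (hγ_lt : γ < 1 / 2) :
    ∃ M : ℕ, ∀ (V : Type*) [Fintype V] (G : SimpleGraph V),
      ∃ G' : SimpleGraph V, G' ≤ G ∧ G'.intervalThickness ≤ (M : ℕ∞) ∧
        (G.edgeSet.ncard : ℝ) - (G'.edgeSet.ncard : ℝ) ≤ γ * (Fintype.card V : ℝ) ^ 2 := by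
  obtain ⟨c, hc, h⟩ := exists_intervalColorable_le γ hγ_pos
  obtain ⟨M, hM⟩ := exists_nat_gt (1 / c)
  refine ⟨M, fun V _ G => ?_⟩
  obtain ⟨G', hG', j, hj, hdec, hcase⟩ :=
    exists_hasIntervalDecomposition (G := G) (fun F _ hF => h V F hF) M
  refine ⟨G', hG', hdec.intervalThickness_le.trans (by exact_mod_cast hj), ?_⟩
  rcases hcase with hcase | hcase
  · exact hcase
  · -- Here `c * M > 1`, so that `G'` could only have so many edges if there is no vertex.
    have h₁ := G'.ncard_edgeSet_le_sq
    have h₂ := G.ncard_edgeSet_le_sq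
    rw [div_lt_iff₀ hc] at hM
    have hn : (Fintype.card V : ℝ) ^ 2 = 0 := by
      have : (0 : ℝ) ≤ (Fintype.card V : ℝ) ^ 2 := by positivity
      nlinarith
    have : (0 : ℝ) ≤ G'.edgeSet.ncard := by positivity
    rw [hn] at h₂ ⊢
    linarith
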